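/- Conventions: a metric space is proper if its closed balls are compact; $B(x,r)$ denotes an open ball; $\dim$ is Hausdorff dimension; $\fint$ denotes a mean value, $\fint_B u\,d\mu=\mu(B)^{-1}\int_B u\,d\mu$, and $f_B=\fint_B f\,d\mu$. For a map $f\colon X\to Y$ of metric spaces, a Borel function $g\colon X\to[0,\infty]$ is an upper gradient of $f$ if $d_Y(f(\gamma(0)),f(\gamma(1)))\le\int_\gamma g\,ds$ for every rectifiable curve $\gamma\colon[0,1]\to X$, and $g\in L^p_{\mathrm{loc}}(X)$ means $\int_K g^p\,d\mu<\infty$ for every compact $K\subseteq X$. Theorem 1.4. Let $Q\ge 1$, $0<s<Q$ and $p>Q$. Let $(X,d_X)$ be a proper metric space with a Borel measure $\mu$ that is positive on non-empty open sets and finite on balls. Assume that for every compact $K\subseteq X$ the following hold. (i) (local $Q$-homogeneity) There are $R>0$ and $C\ge1$ such that $$\frac{\mu(B(x,r_2))}{r_2^Q}\le C\,\frac{\mu(B(x,r_1))}{r_1^Q}\qquad\text{for all }x\in K,\ 0<r_1\le r_2<R.$$ (ii) (local $Q$-Poincaré inequality) There are $C\ge1$, $\sigma\ge1$ and $R>0$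 such that, for every continuous $f\colon X\to\mathbb R$, every upper gradient $g$ of $f$, and every ball $B=B(x,r)$ with $x\in K$ and $0<r<R$, writing $\sigma B=B(x,\sigma r)$, $$\fint_B|f-f_B|\,d\mu\le C\,(\operatorname{diam}B)\left(\fint_{\sigma B}g^Q\,d\mu\right)^{1/Q}.$$ Let $W$ be a proper metric space and let $\pi\colon X\to W$ be a locally David–Semmes $s$-regular surjection: for every compact $K\subseteq X$ the restriction $\pi|_K$ is Lipschitz, and there are $C\ge1$ and $r_0>0$ such that for every ball $B\subseteq W$ of radius $0<r<r_0$ the set $\pi^{-1}(B)\cap K$ can be covered by at most $Cr^{-s}$ balls in $X$ of radius $Cr$. Let $Y$ be any metric space and let $f\colon X\to Y$ be a continuous map that has an upper gradient in $L^p_{\mathrm{loc}}(X)$. Then for every $\alpha\in\left(s,\frac{ps}{p-Q+s}\right]$, $$\dim\{a\in W:\dim f(\pi^{-1}(a))\ge\alpha\}\le (Q-s)-p\left(1-\frac s\alpha\right).$$ -/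

import Mathlib

open MeasureTheory Set Metric
open scoped ENNReal

namespace MetricSobolev

/-- The integral `∫_γ g ds` of `g : X → [0,∞]` along a curve `γ : [0,1] → X`, defined through the
arc-length parametrization of `γ`, which lives on `[0, length γ]`. It is only used for rectifiable
curves, that is, when the length `eVariationOn γ univ` is finite. -/
noncomputable def arcLengthIntegral {X : Type*} [MetricSpace X] (γ : C(unitInterval, X)) (g : X → ℝ≥0∞) : ℝ≥0∞ :=
  ∫⁻ t in Icc (0 : ℝ) (eVariationOn γ univ).toReal, g (naturalParameterization γ univ 0 t)

/-- The Borel function `g : X → [0,∞]` is an upper gradient of `f : X → Y`: along every rectifiable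
curve `γ : [0,1] → X` one has `d(f(γ(0)), f(γ(1))) ≤ ∫_γ g ds`. -/
def IsUpperGradient {X Y : Type*} [MetricSpace X] [MeasurableSpace X] [MetricSpace Y]
    (f : X → Y) (g : X → ℝ≥0∞) : Prop :=
  Measurable g ∧
    ∀ γ : C(unitInterval, X), eVariationOn γ univ ≠ ∞ → edist (f (γ 0)) (f (γ 1)) ≤ arcLengthIntegral γ g

/-- `g ∈ L^p_loc(X)` for a measurable function `g : X → [0,∞]` on a proper space: `g^p` has finite
integral over every compact set. -/
def MemLpLoc {X : Type*} [MetricSpace X] [MeasurableSpace X] (μ : Measure X) (p : ℝ)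
    (g : X → ℝ≥0∞) : Prop :=
  ∀ K : Set X, IsCompact K → ∫⁻ x in K, g x ^ p ∂μ < ∞

/-- `(X, d, μ)` is locally `Q`-homogeneous. -/
def LocallyHomogeneous {X : Type*} [MetricSpace X] [MeasurableSpace X] (μ : Measure X)
    (Q : ℝ) : Prop :=
  ∀ K : Set X, IsCompact K → ∃ R : ℝ, 0 < R ∧ ∃ C : ℝ, 1 ≤ C ∧
    ∀ x ∈ K, ∀ r₁ r₂ : ℝ, 0 < r₁ → r₁ ≤ r₂ → r₂ < R →
      μ (ball x r₂) / ENNReal.ofReal (r₂ ^ Q) ≤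
        ENNReal.ofReal C * (μ (ball x r₁) / ENNReal.ofReal (r₁ ^ Q))

/-- `(X, d, μ)` supports a local `p`-Poincaré inequality. -/
def LocalPoincare {X : Type*} [MetricSpace X] [MeasurableSpace X] (μ : Measure X)
    (p : ℝ) : Prop :=
  ∀ K : Set X, IsCompact K → ∃ C : ℝ, 1 ≤ C ∧ ∃ σ : ℝ, 1 ≤ σ ∧ ∃ R : ℝ, 0 < R ∧
    ∀ (f : X → ℝ) (g : X → ℝ≥0∞), Continuous f → IsUpperGradient f g →
      ∀ x ∈ K, ∀ r : ℝ, 0 < r → r < R →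
        ⨍⁻ y in ball x r, ENNReal.ofReal |f y - ⨍ z in ball x r, f z ∂μ| ∂μ ≤
          ENNReal.ofReal C * ediam (ball x r) * (⨍⁻ y in ball x (σ * r), g y ^ p ∂μ) ^ (1 / p)

/-- `π : X → W` is a locally David–Semmes `s`-regular surjection, that is, `(X, W, π)` is an
`s`-foliation. -/
def IsLocallyRegular {X W : Type*} [MetricSpace X] [MetricSpace W] (s : ℝ) (π : X → W) : Prop :=
  Function.Surjective π ∧
    ∀ K : Set X, IsCompact K →
      (∃ L : NNReal, LipschitzOnWith L π K) ∧
      ∃ C : ℝ, 1 ≤ C ∧ ∃ r₀ : ℝ, 0 < r₀ ∧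
        ∀ (w : W) (r : ℝ), 0 < r → r < r₀ →
          ∃ t : Finset X, (t.card : ℝ) ≤ C * r ^ (-s) ∧
            π ⁻¹' ball w r ∩ K ⊆ ⋃ x ∈ t, ball x (C * r)

end MetricSobolev

/-! Since `p > Q`, Morrey's inequality bounds `diam f(B)` for a ball `B` of radius `r` by `r ^ (1 -
Q/p)` times the `L^p` norm of `g` on a dilate of `B` (`exists_ediam_image_ball_le`). Cover a compact
`K` by balls of radius `r` centred at an `r`-net. The dilates overlap boundedly, so the sum of `diam
f(B) ^ p` is `O(r ^ (p - Q))`, while regularity of `π` lets a fibre meet only `O(r ^ (-s))` of the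
balls (`exists_covering_of_memLpLoc`).

If the image of a fibre has infinite `a`-dimensional measure, `a ≤ p`, the balls meeting that fibre
eventually satisfy `∑ diam f(B) ^ a ≥ 1`. By Hölder their `p`-energy is at least a constant times `r
^ (s * (p/a - 1))`. As `π` is Lipschitz on `K`, well separated points of `W` have fibres meeting
disjoint sets of balls, so comparing with the total energy leaves room for only `O(r ^ (-β))` such
points, where `β = (Q - s) - p * (1 - s/a)` (`card_le_of_one_le_sum_ediam`). Hence these points form
a null set for `H^b` whenever `b ≥ 0` and `b > β` (`hausdorffMeasure_setOf_eq_top_eq_zero`).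
Exhausting `X` by compact sets and letting `a` increase to `α` gives the theorem. -/

namespace MetricSobolev

open Filter Topology
open scoped NNReal

/-! ### Measure of balls and counting of separated points. -/

section Homogeneous

variable {X : Type*} [MetricSpace X] [MeasurableSpace X] {μ : Measure X} {Q : ℝ}

/-- Local homogeneity, written without division. -/
theorem LocallyHomogeneous.exists_measure_ball_le (h : LocallyHomogeneous μ Q) {K : Set X}
    (hK : IsCompact K) :
    ∃ R : ℝ, 0 < R ∧ ∃ C : ℝ, 1 ≤ C ∧ ∀ x ∈ K, ∀ A r : ℝ, 1 ≤ A → 0 < r → A * r < R →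
      μ (ball x (A * r)) ≤ ENNReal.ofReal (C * A ^ Q) * μ (ball x r) := by
  obtain ⟨R, hR, C, hC, H⟩ := h K hK
  refine ⟨R, hR, C, hC, fun x hx A r hA hr hAr => ?_⟩
  have hA0 : 0 < A := by linarith
  have h1 := H x hx r (A * r) hr (le_mul_of_one_le_left hr.le hA) hAr
  have hp : 0 < r ^ Q := Real.rpow_pos_of_pos hr Q
  have hp' : 0 < (A * r) ^ Q := Real.rpow_pos_of_pos (mul_pos hA0 hr) Q
  rw [ENNReal.div_le_iff (by simpa using hp') ENNReal.ofReal_ne_top] at h1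
  refine h1.trans_eq ?_
  rw [Real.mul_rpow hA0.le hr.le, ENNReal.ofReal_mul (by positivity),
    ENNReal.ofReal_mul (by positivity), ENNReal.div_eq_inv_mul]
  have : (ENNReal.ofReal (r ^ Q))⁻¹ * ENNReal.ofReal (r ^ Q) = 1 :=
    ENNReal.inv_mul_cancel (by simpa using hp) ENNReal.ofReal_ne_top
  calc _ = ENNReal.ofReal C * ENNReal.ofReal (A ^ Q) * μ (ball x r) *
        ((ENNReal.ofReal (r ^ Q))⁻¹ * ENNReal.ofReal (r ^ Q)) := by ring
    _ = _ := by rw [this, mul_one]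

/-- Balls of a fixed radius centred in a compact set have measure bounded away from zero. -/
theorem exists_pos_le_measure_ball [μ.IsOpenPosMeasure] {K : Set X}
    (hK : IsCompact K) {r : ℝ} (hr : 0 < r) :
    ∃ c : ℝ, 0 < c ∧ ∀ x ∈ K, ENNReal.ofReal c ≤ μ (ball x r) := by
  obtain ⟨t, -, htf, ht⟩ := hK.finite_cover_balls (half_pos hr)
  have key : ∃ c : ℝ≥0∞, 0 < c ∧ ∀ y ∈ t, c ≤ μ (ball y (r / 2)) := by
    refine ⟨htf.toFinset.inf fun y => μ (ball y (r / 2)), ?_, fun y hy => ?_⟩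
    · rw [Finset.lt_inf_iff (by simp)]
      exact fun y _ => measure_ball_pos μ y (half_pos hr)
    · exact Finset.inf_le (f := fun y => μ (ball y (r / 2))) (htf.mem_toFinset.2 hy)
  obtain ⟨c, hc, hct⟩ := key
  -- The infimum may be `∞`, for instance over an empty cover, so a finite value below it is taken.
  obtain ⟨d, hd0, hdc⟩ := ENNReal.lt_iff_exists_nnreal_btwn.1 hc
  refine ⟨d, by exact_mod_cast hd0, fun x hx => ?_⟩
  obtain ⟨y, hy, hxy⟩ := mem_iUnion₂.1 (ht hx)
  rw [ENNReal.ofReal_coe_nnreal]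
  refine hdc.le.trans ((hct y hy).trans (measure_mono (ball_subset_ball' ?_)))
  rw [dist_comm]
  linarith [mem_ball.1 hxy]

/-- Local homogeneity bounds the measure of small balls from below by a power of the radius. -/
theorem LocallyHomogeneous.exists_le_measure_ball [μ.IsOpenPosMeasure]
    (h : LocallyHomogeneous μ Q) {K : Set X} (hK : IsCompact K) :
    ∃ R : ℝ, 0 < R ∧ ∃ c : ℝ, 0 < c ∧ ∀ x ∈ K, ∀ r : ℝ, 0 < r → r < R →
      ENNReal.ofReal (c * r ^ Q) ≤ μ (ball x r) := by
  obtain ⟨R, hR, C, hC, H⟩ := h.exists_measure_ball_le hK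
  obtain ⟨c, hc, hcK⟩ := exists_pos_le_measure_ball (μ := μ) hK (half_pos hR)
  refine ⟨R / 2, half_pos hR, c / (C * (R / 2) ^ Q), by positivity, fun x hx r hr hrR => ?_⟩
  have h1 := H x hx (R / 2 / r) r ((one_le_div hr).2 hrR.le) hr
    (by rw [div_mul_cancel₀ _ hr.ne']; linarith)
  rw [div_mul_cancel₀ _ hr.ne', Real.div_rpow (by positivity) hr.le] at h1
  have h2 := (hcK x hx).trans h1
  have hk : 0 < C * ((R / 2) ^ Q / r ^ Q) := by positivity
  have e : c / (C * (R / 2) ^ Q) * r ^ Q = c / (C * ((R / 2) ^ Q / r ^ Q)) := by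
    have : r ^ Q ≠ 0 := by positivity
    have : (R / 2) ^ Q ≠ 0 := by positivity
    field_simp
  rw [e, ENNReal.ofReal_div_of_pos hk]
  exact ENNReal.div_le_of_le_mul' h2

/-- Separated sets in a ball of comparable radius have uniformly bounded cardinality. -/
theorem LocallyHomogeneous.exists_card_le [BorelSpace X] [ProperSpace X] [μ.IsOpenPosMeasure]
    [IsFiniteMeasureOnCompacts μ]
    (h : LocallyHomogeneous μ Q) {K : Set X} (hK : IsCompact K) {A : ℝ} (hA : 0 < A) :
    ∃ R : ℝ, 0 < R ∧ ∃ M : ℝ, 0 < M ∧ ∀ (z : X) (r : ℝ), 0 < r → r < R → ∀ S : Finset X,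
      (∀ x ∈ S, x ∈ K ∧ dist x z < A * r) →
      ((S : Set X).Pairwise fun x y => r ≤ dist x y) → (S.card : ℝ) ≤ M := by
  obtain ⟨R, hR, C, hC, H⟩ := h.exists_measure_ball_le hK
  -- Volume counting: the disjoint balls of radius `r / 2` about `S` lie in `V`, and `V` lies in
  -- each ball of radius `(4A + 1) r = (8A + 2) (r / 2)` about a point of `S`.
  have hB : (1 : ℝ) ≤ 8 * A + 2 := by linarith
  refine ⟨R / (8 * A + 2), by positivity, C * (8 * A + 2) ^ Q, by positivity,
    fun z r hr hrR S hS hsep => ?_⟩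
  rcases S.eq_empty_or_nonempty with rfl | ⟨x₀, hx₀⟩
  · simp only [Finset.card_empty, Nat.cast_zero]; positivity
  set D := C * (8 * A + 2) ^ Q with hD
  have hD0 : 0 < D := by positivity
  rw [lt_div_iff₀ (by positivity)] at hrR
  have hdist : ∀ x ∈ S, dist x x₀ < 2 * A * r := fun x hx => by
    have := dist_triangle_right x x₀ z
    linarith [(hS x hx).2, (hS x₀ hx₀).2]
  set V := ball x₀ ((2 * A + 1) * r)
  have hV : ∀ x ∈ S, μ V ≤ ENNReal.ofReal D * μ (ball x (r / 2)) := fun x hx => by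
    refine (measure_mono (ball_subset_ball' ?_)).trans
      (H x (hS x hx).1 (8 * A + 2) (r / 2) hB (half_pos hr) (by nlinarith))
    rw [dist_comm]
    nlinarith [hdist x hx]
  have hsum : ∑ x ∈ S, μ (ball x (r / 2)) ≤ μ V := by
    rw [← measure_biUnion_finset _ fun x _ => measurableSet_ball]
    · refine measure_mono (iUnion₂_subset fun x hx => ball_subset_ball' ?_)
      nlinarith [hdist x hx]
    · intro x hx y hy hxy
      exact ball_disjoint_ball (by linarith [hsep hx hy hxy])
  have h1 : (S.card : ℝ≥0∞) * μ V ≤ ENNReal.ofReal D * μ V := calc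
    (S.card : ℝ≥0∞) * μ V = ∑ x ∈ S, μ V := by rw [Finset.sum_const, nsmul_eq_mul]
    _ ≤ ∑ x ∈ S, ENNReal.ofReal D * μ (ball x (r / 2)) := Finset.sum_le_sum hV
    _ = ENNReal.ofReal D * ∑ x ∈ S, μ (ball x (r / 2)) := by rw [Finset.mul_sum]
    _ ≤ _ := by gcongr
  have h2 : (S.card : ℝ≥0∞) ≤ ENNReal.ofReal D :=
    (ENNReal.mul_le_mul_iff_left (measure_ball_pos μ x₀ (by positivity)).ne'
      measure_ball_lt_top.ne).1 h1
  rwa [← ENNReal.ofReal_natCast, ENNReal.ofReal_le_ofReal_iff hD0.le] at h2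

end Homogeneous

/-! ### Separated nets. -/

section Nets

variable {X : Type*} [MetricSpace X]

/-- If the cardinality of `r`-separated finite subsets of `A` is bounded, then `A` has a finite
`r`-separated `r`-net. -/
theorem exists_separated_net_of_card_le {A : Set X} {r : ℝ} (hr : 0 < r) {N : ℕ}
    (h : ∀ T : Finset X, (T : Set X) ⊆ A → ((T : Set X).Pairwise fun x y => r ≤ dist x y) →
      T.card ≤ N) :
    ∃ T : Finset X, (T : Set X) ⊆ A ∧ ((T : Set X).Pairwise fun x y => r ≤ dist x y) ∧
      A ⊆ ⋃ x ∈ T, ball x r := by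
  classical
  let P : ℕ → Prop := fun n => ∃ T : Finset X, (T : Set X) ⊆ A ∧
    ((T : Set X).Pairwise fun x y => r ≤ dist x y) ∧ T.card = n
  have h0 : P 0 := ⟨∅, by simp, by simp, rfl⟩
  -- A separated set of maximal cardinality is a net, since a point it misses could be added.
  obtain ⟨T, hTA, hTs, hTc⟩ := Nat.findGreatest_spec (P := P) (Nat.zero_le N) h0
  refine ⟨T, hTA, hTs, fun a ha => ?_⟩
  by_contra hcon
  simp only [mem_iUnion, mem_ball, not_exists, not_lt] at hcon
  have haT : a ∉ T := fun haT => by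
    have := hcon a haT
    rw [dist_self] at this
    linarith
  have hA' : ((insert a T : Finset X) : Set X) ⊆ A := by
    rw [Finset.coe_insert]
    exact insert_subset ha hTA
  have hs' : ((insert a T : Finset X) : Set X).Pairwise fun x y => r ≤ dist x y := by
    rw [Finset.coe_insert]
    exact hTs.insert fun b hb _ => ⟨hcon b hb, by rw [dist_comm]; exact hcon b hb⟩
  have hle := Nat.le_findGreatest (P := P) (h _ hA' hs') ⟨_, hA', hs', rfl⟩
  rw [Finset.card_insert_of_notMem haT, hTc] at hle
  omega

/-- Pigeonhole: each ball of a finite cover by balls of radius `r / 2` contains at most one point of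
an `r`-separated set. -/
theorem _root_.IsCompact.exists_separated_net {K : Set X} (hK : IsCompact K) {r : ℝ}
    (hr : 0 < r) :
    ∃ T : Finset X, (T : Set X) ⊆ K ∧ ((T : Set X).Pairwise fun x y => r ≤ dist x y) ∧
      K ⊆ ⋃ x ∈ T, ball x r := by
  obtain ⟨t, -, htf, ht⟩ := hK.finite_cover_balls (half_pos hr)
  refine exists_separated_net_of_card_le hr (N := htf.toFinset.card) fun T hTK hTs => ?_
  have hc : ∀ x : X, ∃ y, x ∈ T → y ∈ t ∧ x ∈ ball y (r / 2) := fun x => by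
    by_cases hx : x ∈ T
    · obtain ⟨y, hy, hxy⟩ := mem_iUnion₂.1 (ht (hTK hx))
      exact ⟨y, fun _ => ⟨hy, hxy⟩⟩
    · exact ⟨x, fun h => absurd h hx⟩
  choose φ hφ using hc
  refine Finset.card_le_card_of_injOn φ (fun x hx => by simpa using (hφ x hx).1) ?_
  intro x hx y hy hxy
  by_contra hne
  have h1 := mem_ball.1 (hφ x hx).2
  have h2 := mem_ball.1 (hφ y hy).2
  rw [← hxy] at h2
  linarith [hTs hx hy hne, dist_triangle_right x y (φ x)]

end Nets

/-! ### Mean values. -/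

section Averages

variable {X : Type*} [MeasurableSpace X] {μ : Measure X}

theorem ofReal_abs_setAverage_sub_le {A : Set X} (hA0 : μ A ≠ 0) (hA : μ A ≠ ∞) {u : X → ℝ}
    (hu : IntegrableOn u A μ) (c : ℝ) :
    ENNReal.ofReal |(⨍ x in A, u x ∂μ) - c| ≤ ⨍⁻ x in A, ENNReal.ofReal |u x - c| ∂μ := by
  have : Fact (μ A < ∞) := ⟨hA.lt_top⟩
  have : NeZero (μ.restrict A) := ⟨by rwa [Ne, Measure.restrict_eq_zero]⟩
  have h1 : (⨍ x in A, u x ∂μ) - c = ⨍ x in A, (u x - c) ∂μ := by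
    unfold average
    rw [integral_sub (Integrable.to_average hu) (integrable_const c), integral_const, probReal_univ,
      one_smul]
  rw [h1, ← Real.enorm_eq_ofReal_abs]
  refine (enorm_integral_le_lintegral_enorm _).trans_eq ?_
  simp only [Real.enorm_eq_ofReal_abs]
  rfl

/-- Enlarging the domain of integration from `A` to `B` costs the factor `μ B / μ A ≤ D`. -/
theorem ofReal_abs_setAverage_sub_setAverage_le {A B : Set X} (hAB : A ⊆ B) (hA0 : μ A ≠ 0)
    (hB : μ B ≠ ∞) {u : X → ℝ} (hu : IntegrableOn u B μ) {D : ℝ≥0∞} (hD : μ B ≤ D * μ A) :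
    ENNReal.ofReal |(⨍ x in A, u x ∂μ) - ⨍ x in B, u x ∂μ| ≤
      D * ⨍⁻ x in B, ENNReal.ofReal |u x - ⨍ z in B, u z ∂μ| ∂μ := by
  have hA : μ A ≠ ∞ := ((measure_mono hAB).trans_lt hB.lt_top).ne
  have hB0 : μ B ≠ 0 := fun h => hA0 (measure_mono_null hAB h)
  refine (ofReal_abs_setAverage_sub_le hA0 hA (hu.mono_set hAB) _).trans ?_
  rw [setLAverage_eq, setLAverage_eq]
  refine ENNReal.div_le_of_le_mul ?_
  set I := ∫⁻ x in B, ENNReal.ofReal |u x - ⨍ z in B, u z ∂μ| ∂μ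
  calc _ ≤ I := lintegral_mono_set hAB
    _ = I / μ B * μ B := (ENNReal.div_mul_cancel hB0 hB).symm
    _ ≤ I / μ B * (D * μ A) := by gcongr
    _ = _ := by ring

/-- Jensen's inequality for averages of powers. -/
theorem setLAverage_rpow_le {A : Set X} (hA0 : μ A ≠ 0) (hA : μ A ≠ ∞) {g : X → ℝ≥0∞}
    (hg : Measurable g) {q p : ℝ} (hq : 0 < q) (hqp : q ≤ p) :
    (⨍⁻ x in A, g x ^ q ∂μ) ^ (1 / q) ≤ (⨍⁻ x in A, g x ^ p ∂μ) ^ (1 / p) := by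
  have : Fact (μ A < ∞) := ⟨hA.lt_top⟩
  have : NeZero (μ.restrict A) := ⟨by rwa [Ne, Measure.restrict_eq_zero]⟩
  have := eLpNorm'_le_eLpNorm'_of_exponent_le hq hqp
    ((μ.restrict A univ)⁻¹ • μ.restrict A) (f := g) hg.aestronglyMeasurable
  simpa only [eLpNorm', enorm_eq_self, laverage] using this

end Averages

/-! ### Morrey's inequality from the Poincaré inequality. -/

section Morrey

theorem integrableOn_ball_of_continuous {X : Type*} [MetricSpace X] [ProperSpace X]
    [MeasurableSpace X] [BorelSpace X] {μ : Measure X} [IsFiniteMeasureOnCompacts μ] {u : X → ℝ} (hu : Continuous u) (x : X) (r : ℝ) :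
    IntegrableOn u (ball x r) μ :=
  (hu.continuousOn.integrableOn_compact (isCompact_closedBall x r)).mono_set ball_subset_closedBall

/-- Distance to a point is 1-Lipschitz; this reduces metric-valued maps to real-valued functions. -/
theorem IsUpperGradient.dist_right {X Y : Type*} [MetricSpace X] [MeasurableSpace X] [MetricSpace Y]
    {f : X → Y} {g : X → ℝ≥0∞}
    (h : IsUpperGradient f g) (y : Y) : IsUpperGradient (fun x => dist (f x) y) g := by
  refine ⟨h.1, fun γ hγ => le_trans ?_ (h.2 γ hγ)⟩
  rw [edist_dist, edist_dist]
  exact ENNReal.ofReal_le_ofReal (dist_dist_dist_le_left _ _ _)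

variable {X : Type*} [MetricSpace X] [ProperSpace X] [MeasurableSpace X]
  {μ : Measure X} [IsFiniteMeasureOnCompacts μ] {Q p : ℝ}

variable [μ.IsOpenPosMeasure]

/-- Jensen raises the exponent from `Q` to `p`, and `μ B ≥ c r ^ Q` turns the mean into an integral
at the cost of `r ^ (-Q/p)`. -/
theorem LocalPoincare.exists_setLAverage_le (hpoi : LocalPoincare μ Q)
    (hhom : LocallyHomogeneous μ Q) (hQ : 0 < Q) (hQp : Q < p) {K : Set X} (hK : IsCompact K) :
    ∃ M : ℝ, 0 < M ∧ ∃ σ : ℝ, 1 ≤ σ ∧ ∃ R : ℝ, 0 < R ∧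
      ∀ (u : X → ℝ) (g : X → ℝ≥0∞), Continuous u → IsUpperGradient u g →
        ∀ x ∈ K, ∀ r : ℝ, 0 < r → r < R →
          ⨍⁻ y in ball x r, ENNReal.ofReal |u y - ⨍ z in ball x r, u z ∂μ| ∂μ ≤
            ENNReal.ofReal (M * r ^ (1 - Q / p)) *
              (∫⁻ y in ball x (σ * r), g y ^ p ∂μ) ^ (1 / p) := by
  obtain ⟨C, hC, σ, hσ, R₁, hR₁, H⟩ := hpoi K hK
  obtain ⟨R₂, hR₂, c, hc, Hc⟩ := hhom.exists_le_measure_ball hK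
  have hp : 0 < p := hQ.trans hQp
  refine ⟨C * 2 * c ^ (-(1 / p)), by positivity, σ, hσ, min R₁ R₂, lt_min hR₁ hR₂,
    fun u g hu hg x hx r hr hrR => ?_⟩
  have hr₁ := hrR.trans_le (min_le_left _ _)
  have hr₂ := hrR.trans_le (min_le_right _ _)
  refine (H u g hu hg x hx r hr hr₁).trans ?_
  have hσr : 0 < σ * r := by positivity
  have hm : ENNReal.ofReal (c * r ^ Q) ≤ μ (ball x (σ * r)) :=
    (Hc x hx r hr hr₂).trans (measure_mono (ball_subset_ball (le_mul_of_one_le_left hr.le hσ)))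
  set I := ∫⁻ y in ball x (σ * r), g y ^ p ∂μ
  have hcr : 0 < c * r ^ Q := by positivity
  have h1 : (⨍⁻ y in ball x (σ * r), g y ^ Q ∂μ) ^ (1 / Q) ≤
      ENNReal.ofReal ((c * r ^ Q) ^ (-(1 / p))) * I ^ (1 / p) := by
    refine (setLAverage_rpow_le (measure_ball_pos μ x hσr).ne' measure_ball_lt_top.ne hg.1
      hQ hQp.le).trans ?_
    rw [setLAverage_eq]
    calc (I / μ (ball x (σ * r))) ^ (1 / p) ≤ (I / ENNReal.ofReal (c * r ^ Q)) ^ (1 / p) := by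
          gcongr
      _ = _ := by
          rw [ENNReal.div_rpow_of_nonneg _ _ (by positivity), ENNReal.div_eq_inv_mul,
            ← ENNReal.rpow_neg, ENNReal.ofReal_rpow_of_pos hcr]
  have h2 : ediam (ball x r) ≤ ENNReal.ofReal (2 * r) := by
    rw [← eball_ofReal, ENNReal.ofReal_mul zero_le_two, ENNReal.ofReal_ofNat]
    exact ediam_eball_le
  calc _ ≤ ENNReal.ofReal C * ENNReal.ofReal (2 * r) *
        (ENNReal.ofReal ((c * r ^ Q) ^ (-(1 / p))) * I ^ (1 / p)) := by gcongr
    _ = ENNReal.ofReal (C * (2 * r) * (c * r ^ Q) ^ (-(1 / p))) * I ^ (1 / p) := by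
        rw [← mul_assoc, ← ENNReal.ofReal_mul (by positivity), ← ENNReal.ofReal_mul (by positivity)]
    _ = _ := by
        congr 2
        rw [Real.mul_rpow hc.le (by positivity), ← Real.rpow_mul hr.le, sub_eq_add_neg,
          Real.rpow_add hr, Real.rpow_one, show Q * -(1 / p) = -(Q / p) by ring]
        ring

variable [BorelSpace X]

/-- Comparison of the averages over two nested balls of comparable size. -/
theorem LocalPoincare.exists_ofReal_abs_sub_setAverage_le (hpoi : LocalPoincare μ Q)
    (hhom : LocallyHomogeneous μ Q) (hQ : 0 < Q) (hQp : Q < p) {K : Set X} (hK : IsCompact K) :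
    ∃ M : ℝ, 0 < M ∧ ∃ σ : ℝ, 1 ≤ σ ∧ ∃ R : ℝ, 0 < R ∧
      ∀ (u : X → ℝ) (g : X → ℝ≥0∞), Continuous u → IsUpperGradient u g →
        ∀ x ∈ K, ∀ y ∈ K, ∀ ρ r : ℝ, 0 < ρ → 0 < r → 4 * ρ < R → r < R →
          ball x ρ ⊆ ball y r → ball y r ⊆ ball x (4 * ρ) →
          ENNReal.ofReal |(⨍ z in ball x ρ, u z ∂μ) - ⨍ z in ball y r, u z ∂μ| ≤
            ENNReal.ofReal (M * r ^ (1 - Q / p)) *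
              (∫⁻ z in ball y (σ * r), g z ^ p ∂μ) ^ (1 / p) := by
  obtain ⟨M, hM, σ, hσ, R₁, hR₁, H⟩ := hpoi.exists_setLAverage_le hhom hQ hQp hK
  obtain ⟨R₂, hR₂, C, hC, HC⟩ := hhom.exists_measure_ball_le hK
  -- The factor 4 in the inclusions covers both later uses: halving a ball about a fixed centre, and
  -- doubling the radius while moving the centre by less than `ρ`.
  refine ⟨C * 4 ^ Q * M, by positivity, σ, hσ, min R₁ R₂, lt_min hR₁ hR₂,
    fun u g hu hg x hx y hy ρ r hρ hr hρR hrR h1 h2 => ?_⟩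
  refine (ofReal_abs_setAverage_sub_setAverage_le h1 (measure_ball_pos μ x hρ).ne'
    measure_ball_lt_top.ne (integrableOn_ball_of_continuous hu y r) ((measure_mono h2).trans
      (HC x hx 4 ρ (by norm_num) hρ (hρR.trans_le (min_le_right _ _))))).trans ?_
  calc _ ≤ ENNReal.ofReal (C * 4 ^ Q) * _ :=
        mul_le_mul_right (H u g hu hg y hy r hr (hrR.trans_le (min_le_left _ _))) _
    _ = _ := by
        rw [← mul_assoc, ← ENNReal.ofReal_mul (by positivity)]
        congr 2
        ring

theorem tendsto_setAverage_ball {u : X → ℝ} (hu : Continuous u) (x : X) {r : ℕ → ℝ}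
    (hr0 : ∀ n, 0 < r n) (hr : Tendsto r atTop (𝓝 0)) :
    Tendsto (fun n => ⨍ z in ball x (r n), u z ∂μ) atTop (𝓝 (u x)) := by
  rw [Metric.tendsto_atTop]
  intro ε hε
  obtain ⟨δ, hδ, h⟩ := Metric.continuous_iff.1 hu x (ε / 2) (half_pos hε)
  obtain ⟨N, hN⟩ := eventually_atTop.1 (hr.eventually (gt_mem_nhds hδ))
  refine ⟨N, fun n hn => lt_of_le_of_lt ?_ (half_lt_self hε)⟩
  have h0 := (measure_ball_pos μ x (hr0 n)).ne'
  have h1 : μ (ball x (r n)) ≠ ∞ := measure_ball_lt_top.ne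
  rw [Real.dist_eq, ← ENNReal.ofReal_le_ofReal_iff (half_pos hε).le]
  refine (ofReal_abs_setAverage_sub_le h0 h1 (integrableOn_ball_of_continuous hu _ _) _).trans ?_
  rw [setLAverage_eq]
  refine ENNReal.div_le_of_le_mul ?_
  rw [← setLIntegral_const]
  refine setLIntegral_mono measurable_const fun z hz => ENNReal.ofReal_le_ofReal ?_
  rw [← Real.dist_eq]
  exact (h z ((mem_ball.1 hz).trans (hN n hn))).le

/-- Telescoping: the oscillation of `u` at the centre of a ball around its mean value. -/
theorem LocalPoincare.exists_ofReal_abs_setAverage_sub_apply_le (hpoi : LocalPoincare μ Q)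
    (hhom : LocallyHomogeneous μ Q) (hQ : 0 < Q) (hQp : Q < p) {K : Set X} (hK : IsCompact K) :
    ∃ M : ℝ, 0 < M ∧ ∃ σ : ℝ, 1 ≤ σ ∧ ∃ R : ℝ, 0 < R ∧
      ∀ (u : X → ℝ) (g : X → ℝ≥0∞), Continuous u → IsUpperGradient u g →
        ∀ x ∈ K, ∀ r : ℝ, 0 < r → r < R →
          ENNReal.ofReal |(⨍ z in ball x r, u z ∂μ) - u x| ≤
            ENNReal.ofReal (M * r ^ (1 - Q / p)) *
              (∫⁻ z in ball x (σ * r), g z ^ p ∂μ) ^ (1 / p) := by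
  obtain ⟨M, hM, σ, hσ, R, hR, H⟩ := hpoi.exists_ofReal_abs_sub_setAverage_le hhom hQ hQp hK
  have hp : 0 < p := hQ.trans hQp
  set θ := 1 - Q / p with hθ
  have hθ0 : 0 < θ := by rw [hθ, sub_pos, div_lt_one hp]; exact hQp
  have hq1 : (2 : ℝ)⁻¹ ^ θ < 1 := Real.rpow_lt_one (by norm_num) (by norm_num) hθ0
  -- The means over successively halved balls differ by terms of a geometric series of ratio `2 ^
  -- (-θ)`, summable because `p > Q`.
  refine ⟨M / (1 - (2 : ℝ)⁻¹ ^ θ), div_pos hM (sub_pos.2 hq1), σ, hσ, R / 2, half_pos hR,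
    fun u g hu hg x hx r hr hrR => ?_⟩
  have hM' : 0 < M / (1 - (2 : ℝ)⁻¹ ^ θ) := div_pos hM (sub_pos.2 hq1)
  set J := (∫⁻ z in ball x (σ * r), g z ^ p ∂μ) ^ (1 / p) with hJ
  by_cases hJt : J = ∞
  · rw [hJt, ENNReal.mul_top]
    · exact le_top
    · simpa using by positivity
  set a := J.toReal with ha
  have hJa : J = ENNReal.ofReal a := (ENNReal.ofReal_toReal hJt).symm
  have hrn0 : ∀ n : ℕ, 0 < r * (2 : ℝ)⁻¹ ^ n := fun n => by positivity
  have hrn : ∀ n : ℕ, r * (2 : ℝ)⁻¹ ^ n ≤ r := fun n =>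
    mul_le_of_le_one_right hr.le (pow_le_one₀ (by norm_num) (by norm_num))
  have hlim : Tendsto (fun n : ℕ => r * (2 : ℝ)⁻¹ ^ n) atTop (𝓝 0) := by
    simpa using (tendsto_pow_atTop_nhds_zero_of_lt_one (r := (2 : ℝ)⁻¹) (by norm_num)
      (by norm_num)).const_mul r
  have hstep : ∀ n : ℕ, dist (⨍ z in ball x (r * (2 : ℝ)⁻¹ ^ n), u z ∂μ)
      (⨍ z in ball x (r * (2 : ℝ)⁻¹ ^ (n + 1)), u z ∂μ) ≤
        M * r ^ θ * a * ((2 : ℝ)⁻¹ ^ θ) ^ n := fun n => by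
    have h0 := hrn0 n
    have h1 : r * (2 : ℝ)⁻¹ ^ (n + 1) = r * (2 : ℝ)⁻¹ ^ n / 2 := by rw [pow_succ]; ring
    have h2 := H u g hu hg x hx x hx (r * (2 : ℝ)⁻¹ ^ (n + 1)) (r * (2 : ℝ)⁻¹ ^ n)
      (hrn0 _) h0 (by rw [h1]; linarith [hrn n]) (by linarith [hrn n])
      (ball_subset_ball (by rw [h1]; linarith)) (ball_subset_ball (by rw [h1]; linarith))
    have h3 : (∫⁻ z in ball x (σ * (r * (2 : ℝ)⁻¹ ^ n)), g z ^ p ∂μ) ^ (1 / p) ≤ J := by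
      refine ENNReal.rpow_le_rpow (lintegral_mono_set (ball_subset_ball ?_)) (by positivity)
      have := hrn n
      gcongr
    replace h2 := h2.trans (mul_le_mul_right h3 _)
    rw [hJa, ← ENNReal.ofReal_mul (by positivity), ENNReal.ofReal_le_ofReal_iff (by positivity)]
      at h2
    rw [dist_comm, Real.dist_eq]
    refine h2.trans_eq ?_
    rw [Real.mul_rpow hr.le (by positivity), ← Real.rpow_natCast, ← Real.rpow_natCast,
      ← Real.rpow_mul (by norm_num), ← Real.rpow_mul (by norm_num), mul_comm θ]
    ring
  have hfin := dist_le_of_le_geometric_of_tendsto₀ _ _ hq1 hstep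
    (tendsto_setAverage_ball hu x hrn0 hlim)
  rw [Real.dist_eq, pow_zero, mul_one] at hfin
  rw [hJa, ← ENNReal.ofReal_mul (by positivity)]
  refine ENNReal.ofReal_le_ofReal (hfin.trans_eq ?_)
  ring

/-- Morrey's inequality for real-valued functions. -/
theorem LocalPoincare.exists_ofReal_abs_sub_le (hpoi : LocalPoincare μ Q)
    (hhom : LocallyHomogeneous μ Q) (hQ : 0 < Q) (hQp : Q < p) {K : Set X} (hK : IsCompact K) :
    ∃ M : ℝ, 0 < M ∧ ∃ σ : ℝ, 1 ≤ σ ∧ ∃ R : ℝ, 0 < R ∧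
      ∀ (u : X → ℝ) (g : X → ℝ≥0∞), Continuous u → IsUpperGradient u g →
        ∀ x ∈ K, ∀ y ∈ K, ∀ r : ℝ, dist x y < r → r < R →
          ENNReal.ofReal |u x - u y| ≤ ENNReal.ofReal (M * r ^ (1 - Q / p)) *
              (∫⁻ z in ball x (σ * r), g z ^ p ∂μ) ^ (1 / p) := by
  obtain ⟨M₁, hM₁, σ₁, hσ₁, R₁, hR₁, H₁⟩ :=
    hpoi.exists_ofReal_abs_sub_setAverage_le hhom hQ hQp hK
  obtain ⟨M₂, hM₂, σ₂, hσ₂, R₂, hR₂, H₂⟩ :=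
    hpoi.exists_ofReal_abs_setAverage_sub_apply_le hhom hQ hQp hK
  have hp : 0 < p := hQ.trans hQp
  set θ := 1 - Q / p with hθ
  have hθ0 : 0 < θ := by rw [hθ, sub_pos, div_lt_one hp]; exact hQp
  -- The chain is `u x`, the mean over `B(x, r)`, the mean over `B(y, 2r)`, `u y`. The balls `B(y, 2
  -- σᵢ r)` lie in `B(x, σ r)` because `2 σᵢ + 1 ≤ 3 σᵢ`.
  set σ := 3 * max σ₁ σ₂ with hσ
  have hm₁ := le_max_left σ₁ σ₂
  have hm₂ := le_max_right σ₁ σ₂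
  refine ⟨M₂ + M₁ * 2 ^ θ + M₂ * 2 ^ θ, by positivity, σ, by linarith,
    min (R₁ / 4) (R₂ / 2), lt_min (by positivity) (by positivity),
    fun u g hu hg x hx y hy r hxy hrR => ?_⟩
  have hr : 0 < r := dist_nonneg.trans_lt hxy
  have hr₁ := hrR.trans_le (min_le_left _ _)
  have hr₂ := hrR.trans_le (min_le_right _ _)
  set J := (∫⁻ z in ball x (σ * r), g z ^ p ∂μ) ^ (1 / p) with hJ
  have mono : ∀ (w : X) (t : ℝ), t + dist w x ≤ σ * r →
      (∫⁻ z in ball w t, g z ^ p ∂μ) ^ (1 / p) ≤ J := fun w t h =>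
    ENNReal.rpow_le_rpow (lintegral_mono_set (ball_subset_ball' h)) (by positivity)
  have hyx : dist y x < r := by rwa [dist_comm]
  have e1 := (H₂ u g hu hg x hx r hr (by linarith)).trans
    (mul_le_mul_right (mono x _ (by rw [dist_self, add_zero]; gcongr; linarith)) _)
  have e2 := (H₁ u g hu hg x hx y hy r (2 * r) hr (by linarith) (by linarith) (by linarith)
    (ball_subset_ball' (by linarith)) (ball_subset_ball' (by linarith))).trans
    (mul_le_mul_right (mono y _ (by nlinarith)) _)
  have e3 := (H₂ u g hu hg y hy (2 * r) (by linarith) (by linarith)).trans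
    (mul_le_mul_right (mono y _ (by nlinarith)) _)
  rw [Real.mul_rpow zero_le_two hr.le] at e2 e3
  set A := ⨍ z in ball x r, u z ∂μ
  set B := ⨍ z in ball y (2 * r), u z ∂μ
  have htri : |u x - u y| ≤ |A - u x| + |A - B| + |B - u y| := by
    have := abs_add_three (u x - A) (A - B) (B - u y)
    rw [abs_sub_comm (u x) A] at this
    simpa using this
  calc ENNReal.ofReal |u x - u y| ≤ ENNReal.ofReal (|A - u x| + |A - B| + |B - u y|) :=
        ENNReal.ofReal_le_ofReal htri
    _ = ENNReal.ofReal |A - u x| + ENNReal.ofReal |A - B| + ENNReal.ofReal |B - u y| := by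
        rw [ENNReal.ofReal_add (by positivity) (by positivity),
          ENNReal.ofReal_add (by positivity) (by positivity)]
    _ ≤ _ := add_le_add (add_le_add e1 e2) e3
    _ = _ := by
        rw [← add_mul, ← add_mul, ← ENNReal.ofReal_add (by positivity) (by positivity),
          ← ENNReal.ofReal_add (by positivity) (by positivity)]
        congr 2
        ring

/-- Morrey's inequality for maps into metric spaces. -/
theorem LocalPoincare.exists_ediam_image_ball_le (hpoi : LocalPoincare μ Q)
    (hhom : LocallyHomogeneous μ Q) (hQ : 0 < Q) (hQp : Q < p) {Y : Type*} [MetricSpace Y]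
    {K : Set X} (hK : IsCompact K) :
    ∃ M : ℝ, 0 < M ∧ ∃ σ : ℝ, 1 ≤ σ ∧ ∃ R : ℝ, 0 < R ∧
      ∀ (f : X → Y) (g : X → ℝ≥0∞), Continuous f → IsUpperGradient f g →
        ∀ x ∈ K, ∀ r : ℝ, 0 < r → r < R →
          ediam (f '' ball x r) ≤ ENNReal.ofReal (M * r ^ (1 - Q / p)) *
              (∫⁻ z in ball x (σ * r), g z ^ p ∂μ) ^ (1 / p) := by
  -- Points of a ball centred in `K` may leave `K`, so the real-valued inequality is taken on a
  -- compact neighbourhood.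
  obtain ⟨M, hM, σ, hσ, R, hR, H⟩ :=
    hpoi.exists_ofReal_abs_sub_le hhom hQ hQp (hK.cthickening (r := 1))
  have hp : 0 < p := hQ.trans hQp
  refine ⟨M * 2 ^ (1 - Q / p), by positivity, 3 * σ, by linarith, min 1 (R / 2),
    lt_min one_pos (half_pos hR), fun f g hf hg x hx r hr hrR => ?_⟩
  have hr₁ := hrR.trans_le (min_le_left _ _)
  have hr₂ := hrR.trans_le (min_le_right _ _)
  have hmem : ∀ y ∈ ball x r, y ∈ cthickening 1 K := fun y hy =>
    mem_cthickening_of_dist_le y x 1 K hx ((mem_ball.1 hy).le.trans hr₁.le)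
  refine ediam_image_le_iff.2 fun y hy z hz => ?_
  have hyz : dist y z < 2 * r := by
    linarith [dist_triangle_right y z x, mem_ball.1 hy, mem_ball.1 hz]
  have h1 := H (fun w => dist (f w) (f z)) g (hf.dist continuous_const) (hg.dist_right _) y
    (hmem y hy) z (hmem z hz) (2 * r) hyz (by linarith)
  rw [dist_self, sub_zero, abs_of_nonneg dist_nonneg, ← edist_dist,
    Real.mul_rpow zero_le_two hr.le, ← mul_assoc] at h1
  refine h1.trans (mul_le_mul_right (ENNReal.rpow_le_rpow
    (lintegral_mono_set (ball_subset_ball' ?_)) (by positivity)) _)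
  nlinarith [mem_ball.1 hy]

end Morrey

/-! ### Coverings with controlled energy and fibre counts. -/

section Coverings

/-- Bounded overlap, integrated: at each point the indicators of the `B i` sum to at most `N`. -/
theorem sum_setLIntegral_le {X : Type*} [MeasurableSpace X] {μ : Measure X} {ι : Type*}
    (T : Finset ι) {B : ι → Set X} (hB : ∀ i ∈ T, MeasurableSet (B i)) {V : Set X}
    (hBV : ∀ i ∈ T, B i ⊆ V) {h : X → ℝ≥0∞} (hh : Measurable h) {N : ℝ}
    (hN : ∀ z, ∀ S ⊆ T, (∀ i ∈ S, z ∈ B i) → (S.card : ℝ) ≤ N) :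
    ∑ i ∈ T, ∫⁻ z in B i, h z ∂μ ≤ ENNReal.ofReal N * ∫⁻ z in V, h z ∂μ := by
  classical
  have h1 : ∀ i ∈ T, ∫⁻ z in B i, h z ∂μ = ∫⁻ z in V, (B i).indicator h z ∂μ := fun i hi => by
    rw [lintegral_indicator (hB i hi), Measure.restrict_restrict (hB i hi),
      inter_eq_left.2 (hBV i hi)]
  rw [Finset.sum_congr rfl h1, ← lintegral_finsetSum' _
    fun i hi => (hh.indicator (hB i hi)).aemeasurable, ← lintegral_const_mul _ hh]
  refine lintegral_mono fun z => ?_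
  rw [← Finset.sum_filter_add_sum_filter_not T (fun i => z ∈ B i),
    Finset.sum_congr rfl (g := fun _ => h z)
      (fun i hi => indicator_of_mem (Finset.mem_filter.1 hi).2 h),
    Finset.sum_eq_zero (s := T.filter fun i => z ∉ B i)
      (fun i hi => indicator_of_notMem (Finset.mem_filter.1 hi).2 h), add_zero,
    Finset.sum_const, nsmul_eq_mul]
  gcongr
  rw [← ENNReal.ofReal_natCast]
  exact ENNReal.ofReal_le_ofReal (hN z _ (Finset.filter_subset _ _)
    fun i hi => (Finset.mem_filter.1 hi).2)

/-- A finite sum of `a`-th powers controls the sum of `p`-th powers from below, by Hölder. -/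
theorem one_le_mul_sum_rpow {ι : Type*} (S : Finset ι) {D : ι → ℝ≥0∞} {a p c : ℝ} (ha : 0 < a)
    (hap : a ≤ p) (hS : (S.card : ℝ) ≤ c) (h : 1 ≤ ∑ i ∈ S, D i ^ a) :
    1 ≤ ENNReal.ofReal c ^ (p / a - 1) * ∑ i ∈ S, D i ^ p := by
  have hq : 1 ≤ p / a := (one_le_div ha).2 hap
  calc (1 : ℝ≥0∞) = 1 ^ (p / a) := (ENNReal.one_rpow _).symm
    _ ≤ (∑ i ∈ S, D i ^ a) ^ (p / a) := by gcongr
    _ ≤ (S.card : ℝ≥0∞) ^ (p / a - 1) * ∑ i ∈ S, (D i ^ a) ^ (p / a) :=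
        ENNReal.rpow_sum_le_const_mul_sum_rpow _ _ hq
    _ = (S.card : ℝ≥0∞) ^ (p / a - 1) * ∑ i ∈ S, D i ^ p := by
        simp only [← ENNReal.rpow_mul, mul_div_cancel₀ _ ha.ne']
    _ ≤ _ := by
        gcongr
        · rw [← ENNReal.ofReal_natCast]
          exact ENNReal.ofReal_le_ofReal hS

variable {X W Y : Type*} [MetricSpace X] [ProperSpace X] [MeasurableSpace X] [BorelSpace X]
  [MetricSpace W] [MetricSpace Y] {μ : Measure X} [μ.IsOpenPosMeasure]
  [IsFiniteMeasureOnCompacts μ] {Q s p : ℝ}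

/-- At every small scale `r`, a compact set is covered by finitely many `r`-balls whose images
have `p`-energy at most `M * r ^ (p - Q)` and of which at most `M * r ^ (-s)` meet a given fibre. -/
theorem exists_covering_of_memLpLoc (hhom : LocallyHomogeneous μ Q) (hpoi : LocalPoincare μ Q)
    (hQ : 0 < Q) (hQp : Q < p) {π : X → W} (hπ : IsLocallyRegular s π) {f : X → Y}
    (hf : Continuous f) {g : X → ℝ≥0∞} (hg : IsUpperGradient f g) (hgp : MemLpLoc μ p g)
    {K : Set X} (hK : IsCompact K) :
    ∃ R : ℝ, 0 < R ∧ ∃ M : ℝ, 0 < M ∧ ∀ r : ℝ, 0 < r → r < R → ∃ T : Finset X,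
      K ⊆ ⋃ x ∈ T, ball x r ∧
      ∑ x ∈ T, ediam (f '' ball x r) ^ p ≤ ENNReal.ofReal (M * r ^ (p - Q)) ∧
      ∀ a, ∀ S ⊆ T, (∀ x ∈ S, (ball x r ∩ (K ∩ π ⁻¹' {a})).Nonempty) →
        (S.card : ℝ) ≤ M * r ^ (-s) := by
  classical
  have hp : 0 < p := hQ.trans hQp
  obtain ⟨M₀, hM₀, σ, hσ, R₀, hR₀, H₀⟩ :=
    hpoi.exists_ediam_image_ball_le (Y := Y) hhom hQ hQp hK
  obtain ⟨-, C, hC, R₁, hR₁, H₁⟩ := hπ.2 K hK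
  -- `N₂` bounds the overlap of the `σ r`-balls; `N₃` bounds the net points within `(C + 1) r` of a
  -- centre of the cover given by regularity.
  obtain ⟨R₂, hR₂, N₂, hN₂, H₂⟩ := hhom.exists_card_le hK (A := σ) (by linarith)
  obtain ⟨R₃, hR₃, N₃, hN₃, H₃⟩ := hhom.exists_card_le hK (A := C + 1) (by linarith)
  set E := (∫⁻ z in cthickening 1 K, g z ^ p ∂μ).toReal with hE
  have hEt : ∫⁻ z in cthickening 1 K, g z ^ p ∂μ = ENNReal.ofReal E :=
    (ENNReal.ofReal_toReal (hgp _ hK.cthickening).ne).symm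
  have hE0 : 0 ≤ E := ENNReal.toReal_nonneg
  -- The bound `1 / σ` keeps the dilated balls inside the 1-thickening of `K`. The first summand of
  -- the constant serves the energy, the second the fibre count.
  refine ⟨min (min R₀ R₁) (min (min R₂ R₃) (1 / σ)), by positivity,
    M₀ ^ p * N₂ * E + C * N₃, by positivity, fun r hr hrR => ?_⟩
  simp only [lt_min_iff] at hrR
  obtain ⟨⟨hr₀, hr₁⟩, ⟨hr₂, hr₃⟩, hrσ⟩ := hrR
  rw [lt_div_iff₀ (by linarith)] at hrσ
  obtain ⟨T, hTK, hTs, hT⟩ := hK.exists_separated_net hr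
  refine ⟨T, hT, ?_, fun a S hST hS => ?_⟩
  · have hsum : ∑ x ∈ T, ∫⁻ z in ball x (σ * r), g z ^ p ∂μ ≤
        ENNReal.ofReal N₂ * ∫⁻ z in cthickening 1 K, g z ^ p ∂μ := by
      refine sum_setLIntegral_le T (fun _ _ => measurableSet_ball) (fun x hx y hy => ?_)
        (hg.1.pow_const p) fun z S hST hz => ?_
      · exact mem_cthickening_of_dist_le y x 1 K (hTK hx) (by linarith [mem_ball.1 hy])
      · refine H₂ z r hr hr₂ S (fun x hx => ⟨hTK (hST hx), ?_⟩)
          (hTs.mono (Finset.coe_subset.2 hST))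
        rw [dist_comm]
        exact hz x hx
    have hterm : ∀ x ∈ T, ediam (f '' ball x r) ^ p ≤
        ENNReal.ofReal (M₀ ^ p * r ^ (p - Q)) * ∫⁻ z in ball x (σ * r), g z ^ p ∂μ :=
      fun x hx => by
        refine (ENNReal.rpow_le_rpow (H₀ f g hf hg x (hTK hx) r hr hr₀) hp.le).trans_eq ?_
        rw [ENNReal.mul_rpow_of_nonneg _ _ hp.le, ← ENNReal.rpow_mul, one_div_mul_cancel hp.ne',
          ENNReal.rpow_one, ENNReal.ofReal_rpow_of_pos (by positivity),
          Real.mul_rpow hM₀.le (by positivity), ← Real.rpow_mul hr.le]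
        congr 4
        field_simp
    calc _ ≤ ∑ x ∈ T, ENNReal.ofReal (M₀ ^ p * r ^ (p - Q)) *
          ∫⁻ z in ball x (σ * r), g z ^ p ∂μ := Finset.sum_le_sum hterm
      _ ≤ ENNReal.ofReal (M₀ ^ p * r ^ (p - Q)) * (ENNReal.ofReal N₂ * ENNReal.ofReal E) := by
          rw [← Finset.mul_sum, ← hEt]
          gcongr
      _ = ENNReal.ofReal (M₀ ^ p * r ^ (p - Q) * (N₂ * E)) := by
          rw [← ENNReal.ofReal_mul hN₂.le, ← ENNReal.ofReal_mul (by positivity)]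
      _ ≤ _ := by
          refine ENNReal.ofReal_le_ofReal ?_
          have : 0 ≤ C * N₃ * r ^ (p - Q) := by positivity
          linarith
  · obtain ⟨t, htc, ht⟩ := H₁ a r hr hr₁
    -- A net ball meeting the fibre meets one of the `C r`-balls covering it, so its centre is
    -- within `(C + 1) r` of that ball's centre.
    have hcov : S ⊆ t.biUnion fun y => S.filter fun x => dist x y < (C + 1) * r := fun x hx => by
      obtain ⟨z, hzx, hzK, hza⟩ := hS x hx
      have hza' : π z ∈ ball a r := by
        rw [mem_preimage, mem_singleton_iff] at hza
        rw [hza]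
        exact mem_ball_self hr
      obtain ⟨y, hy, hzy⟩ := mem_iUnion₂.1 (ht ⟨hza', hzK⟩)
      refine Finset.mem_biUnion.2 ⟨y, hy, Finset.mem_filter.2 ⟨hx, ?_⟩⟩
      linarith [dist_triangle_left x y z, mem_ball.1 hzx, mem_ball.1 hzy]
    have hle : ∀ y ∈ t, ((S.filter fun x => dist x y < (C + 1) * r).card : ℝ) ≤ N₃ :=
      fun y _ => H₃ y r hr hr₃ _
        (fun x hx => ⟨hTK (hST (Finset.mem_filter.1 hx).1), (Finset.mem_filter.1 hx).2⟩)
        (hTs.mono (Finset.coe_subset.2 ((Finset.filter_subset _ _).trans hST)))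
    calc (S.card : ℝ) ≤ ∑ y ∈ t, ((S.filter fun x => dist x y < (C + 1) * r).card : ℝ) := by
          exact_mod_cast (Finset.card_le_card hcov).trans Finset.card_biUnion_le
      _ ≤ t.card * N₃ := by
          simpa using Finset.sum_le_sum hle
      _ ≤ C * r ^ (-s) * N₃ := by gcongr
      _ ≤ _ := by
          have : 0 ≤ M₀ ^ p * N₂ * E * r ^ (-s) := by positivity
          linarith

end Coverings

/-! ### Counting fibres with large image. -/

section Fibres

variable {X W Y : Type*} [MetricSpace X] [MetricSpace W] [MetricSpace Y]

/-- If the balls of radius `r` centred at `T` have small `p`-energy, then the points of `W` whose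
fibres have large `a`-content at scale `r` cannot contain a large separated set. -/
theorem card_le_of_one_le_sum_ediam {π : X → W} {f : X → Y} {K : Set X} {L : ℝ≥0}
    (hL : LipschitzOnWith L π K) {T : Finset X} {r a p c E : ℝ} (hr : 0 < r) (ha : 0 < a)
    (hap : a ≤ p) (hc : 0 < c) (hE : 0 ≤ E)
    (hT : ∑ x ∈ T, ediam (f '' ball x r) ^ p ≤ ENNReal.ofReal E) {hit : W → Finset X}
    (hhit : ∀ w, hit w ⊆ T)
    (hmeet : ∀ w, ∀ x ∈ hit w, (ball x r ∩ (K ∩ π ⁻¹' {w})).Nonempty)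
    (hcard : ∀ w, ((hit w).card : ℝ) ≤ c) {A : Finset W}
    (hA : ∀ w ∈ A, 1 ≤ ∑ x ∈ hit w, ediam (f '' ball x r) ^ a)
    (hsep : (A : Set W).Pairwise fun v w => 3 * (L + 1) * r ≤ dist v w) :
    (A.card : ℝ) ≤ c ^ (p / a - 1) * E := by
  classical
  -- A ball shared by the fibres of `v` and `w` would give `dist v w ≤ 2 L r`, against the
  -- separation.
  have hdisj : (A : Set W).PairwiseDisjoint hit := by
    intro v hv w hw hvw
    refine Finset.disjoint_left.2 fun x hxv hxw => ?_
    obtain ⟨y, hy, hyK, hyv⟩ := hmeet v x hxv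
    obtain ⟨z, hz, hzK, hzw⟩ := hmeet w x hxw
    rw [mem_preimage, mem_singleton_iff] at hyv hzw
    have h1 := hL.dist_le_mul y hyK z hzK
    rw [hyv, hzw] at h1
    have h2 : dist y z ≤ 2 * r := by
      linarith [dist_triangle_right y z x, mem_ball.1 hy, mem_ball.1 hz]
    have h3 : (L : ℝ) * dist y z ≤ L * (2 * r) := by gcongr
    have h4 : 0 ≤ (L : ℝ) * r := by positivity
    linarith [hsep hv hw hvw]
  have h1 : (A.card : ℝ≥0∞) ≤ ENNReal.ofReal c ^ (p / a - 1) * ENNReal.ofReal E := calc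
    (A.card : ℝ≥0∞) = ∑ w ∈ A, 1 := by simp
    _ ≤ ∑ w ∈ A, ENNReal.ofReal c ^ (p / a - 1) * ∑ x ∈ hit w, ediam (f '' ball x r) ^ p :=
        Finset.sum_le_sum fun w hw => one_le_mul_sum_rpow _ ha hap (hcard w) (hA w hw)
    _ = ENNReal.ofReal c ^ (p / a - 1) *
          ∑ x ∈ A.biUnion hit, ediam (f '' ball x r) ^ p := by
        rw [← Finset.mul_sum, Finset.sum_biUnion hdisj]
    _ ≤ ENNReal.ofReal c ^ (p / a - 1) * ∑ x ∈ T, ediam (f '' ball x r) ^ p := by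
        gcongr
        exact Finset.biUnion_subset.2 fun w _ => hhit w
    _ ≤ _ := by gcongr
  rw [ENNReal.ofReal_rpow_of_pos hc, ← ENNReal.ofReal_mul (by positivity),
    ← ENNReal.ofReal_natCast] at h1
  exact (ENNReal.ofReal_le_ofReal_iff (by positivity)).1 h1

variable [ProperSpace X] [MeasurableSpace X] [BorelSpace X] {μ : Measure X}
  [μ.IsOpenPosMeasure] [IsFiniteMeasureOnCompacts μ] {Q s p : ℝ}

open scoped MeasureTheory.Measure in
/-- The set of fibres whose image has infinite `a`-dimensional measure is null for every Hausdorff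
measure of dimension exceeding `(Q - s) - p * (1 - s / a)`. -/
theorem hausdorffMeasure_setOf_eq_top_eq_zero [MeasurableSpace W] [BorelSpace W]
    [MeasurableSpace Y] [BorelSpace Y] (hhom : LocallyHomogeneous μ Q) (hpoi : LocalPoincare μ Q)
    (hQ : 0 < Q) (hQp : Q < p) {π : X → W} (hπ : IsLocallyRegular s π) {f : X → Y}
    (hf : Continuous f) {g : X → ℝ≥0∞} (hg : IsUpperGradient f g) (hgp : MemLpLoc μ p g)
    {K : Set X} (hK : IsCompact K) {a b : ℝ} (ha : 0 < a) (hap : a ≤ p) (hb0 : 0 ≤ b)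
    (hb : (Q - s) - p * (1 - s / a) < b) :
    μH[b] {w | μH[a] (f '' (K ∩ π ⁻¹' {w})) = ∞} = 0 := by
  classical
  have hp : 0 < p := hQ.trans hQp
  obtain ⟨R, hR, M, hM, H⟩ := exists_covering_of_memLpLoc hhom hpoi hQ hQp hπ hf hg hgp hK
  obtain ⟨⟨L, hL⟩, -⟩ := hπ.2 K hK
  set r : ℕ → ℝ := fun n => R / 2 * (2 : ℝ)⁻¹ ^ n with hr
  have hr0 : ∀ n, 0 < r n := fun n => by positivity
  have hrR : ∀ n, r n < R := fun n =>
    (mul_le_of_le_one_right (by positivity) (pow_le_one₀ (by norm_num) (by norm_num))).trans_lt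
      (half_lt_self hR)
  have hrlim : Tendsto r atTop (𝓝 0) := by
    simpa [hr] using (tendsto_pow_atTop_nhds_zero_of_lt_one (r := (2 : ℝ)⁻¹) (by norm_num)
      (by norm_num)).const_mul (R / 2)
  have hpow : ∀ e : ℝ, 0 < e → ∀ c : ℝ, Tendsto (fun n => ENNReal.ofReal (c * r n ^ e)) atTop
      (𝓝 0) := fun e he c => by
    have := ((Real.continuousAt_rpow_const 0 e (Or.inr he.le)).tendsto.comp hrlim).const_mul c
    rw [Real.zero_rpow he.ne', mul_zero] at this
    simpa using ENNReal.tendsto_ofReal this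
  choose T hTK hTE hTc using fun n => H (r n) (hr0 n) (hrR n)
  let hit : ℕ → W → Finset X := fun n w =>
    (T n).filter fun x => (ball x (r n) ∩ (K ∩ π ⁻¹' {w})).Nonempty
  have hitT : ∀ n w, hit n w ⊆ T n := fun n w => Finset.filter_subset _ _
  have hitm : ∀ n w, ∀ x ∈ hit n w, (ball x (r n) ∩ (K ∩ π ⁻¹' {w})).Nonempty :=
    fun n w x hx => (Finset.mem_filter.1 hx).2
  -- Countably many pieces, on each of which the lower bound holds at all scales from a common index
  -- on.
  let Z : ℕ → Set W := fun N =>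
    {w | ∀ n ≥ N, 1 ≤ ∑ x ∈ hit n w, ediam (f '' ball x (r n)) ^ a}
  have hsub : {w | μH[a] (f '' (K ∩ π ⁻¹' {w})) = ∞} ⊆ ⋃ N, Z N := by
    intro w hw
    have hdiam : ∀ n, ∀ x ∈ T n, ediam (f '' ball x (r n)) ≤
        ENNReal.ofReal (M * r n ^ (p - Q)) ^ (1 / p) := fun n x hx => by
      rw [one_div, ENNReal.le_rpow_inv_iff hp]
      exact (Finset.single_le_sum (f := fun x => ediam (f '' ball x (r n)) ^ p)
        (fun _ _ => zero_le) hx).trans (hTE n)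
    have hlim : Tendsto (fun n => ENNReal.ofReal (M * r n ^ (p - Q)) ^ (1 / p)) atTop (𝓝 0) := by
      have := (ENNReal.continuous_rpow_const (y := 1 / p)).continuousAt.tendsto.comp
        (hpow (p - Q) (sub_pos.2 hQp) M)
      rwa [ENNReal.zero_rpow_of_pos (by positivity)] at this
    have hle := Measure.hausdorffMeasure_le_liminf_sum (ι := fun n => hit n w) a
      (f '' (K ∩ π ⁻¹' {w})) _ hlim (fun n x => f '' ball (x : X) (r n))
      (Eventually.of_forall fun n x => hdiam n x (hitT n w x.2))
      (Eventually.of_forall fun n => by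
        rintro _ ⟨z, hz, rfl⟩
        obtain ⟨x, hx, hzx⟩ := mem_iUnion₂.1 (hTK n hz.1)
        exact mem_iUnion.2 ⟨⟨x, Finset.mem_filter.2 ⟨hx, z, hzx, hz⟩⟩, z, hzx, rfl⟩)
    rw [show μH[a] (f '' (K ∩ π ⁻¹' {w})) = ∞ from hw, top_le_iff] at hle
    -- Infinite measure forces the covering sums to tend to `∞`; any positive threshold would do in
    -- place of 1.
    have hev := eventually_lt_of_lt_liminf (hle ▸ ENNReal.one_lt_top)
    obtain ⟨N, hN⟩ := eventually_atTop.1 hev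
    refine mem_iUnion.2 ⟨N, fun n hn => (hN n hn).le.trans_eq ?_⟩
    exact Finset.sum_coe_sort (hit n w) fun x => ediam (f '' ball x (r n)) ^ a
  refine measure_mono_null hsub (measure_iUnion_null fun N => ?_)
  set B := M ^ (p / a - 1) * M with hB
  -- `e` is the negative of the critical exponent `(Q - s) - p * (1 - s / a)`.
  set e := -s * (p / a - 1) + (p - Q) with he
  have hcard : ∀ n ≥ N, ∀ A : Finset W, (A : Set W) ⊆ Z N →
      ((A : Set W).Pairwise fun v w => 3 * (L + 1) * r n ≤ dist v w) →
      (A.card : ℝ) ≤ B * r n ^ e := fun n hn A hAZ hA => by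
    have h0 := hr0 n
    refine (card_le_of_one_le_sum_ediam (c := M * r n ^ (-s)) hL h0 ha hap (by positivity)
      (by positivity) (hTE n) (hitT n) (hitm n) (fun w => hTc n w _ (hitT n w) (hitm n w))
      (fun w hw => hAZ hw n hn) hA).trans_eq ?_
    rw [Real.mul_rpow hM.le (by positivity), ← Real.rpow_mul h0.le, he, Real.rpow_add h0]
    ring
  have hnet : ∀ n, ∃ A : Finset W, n ≥ N → (A.card : ℝ) ≤ B * r n ^ e ∧
      Z N ⊆ ⋃ w ∈ A, ball w (3 * (L + 1) * r n) := fun n => by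
    by_cases hn : n ≥ N
    · have h0 := hr0 n
      -- The energy count itself bounds separated subsets of `Z N`, hence yields a finite net there.
      obtain ⟨A, hAZ, hAs, hA⟩ := exists_separated_net_of_card_le (A := Z N)
        (r := 3 * (L + 1) * r n) (by positivity) (N := ⌊B * r n ^ e⌋₊)
        fun A hAZ hAs => Nat.le_floor (hcard n hn A hAZ hAs)
      exact ⟨A, fun _ => ⟨hcard n hn A hAZ hAs, hA⟩⟩
    · exact ⟨∅, fun h => absurd h hn⟩
  choose A hA using hnet
  have hdiam : ∀ n (w : W), ediam (ball w (3 * (L + 1) * r n)) ≤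
      ENNReal.ofReal (6 * (L + 1) * r n ^ (1 : ℝ)) := fun n w => by
    have : (6 * (L + 1) * r n ^ (1 : ℝ) : ℝ) = 2 * (3 * (L + 1) * r n) := by
      rw [Real.rpow_one]; ring
    rw [← eball_ofReal, this, ENNReal.ofReal_mul zero_le_two, ENNReal.ofReal_ofNat]
    exact ediam_eball_le
  have hle := Measure.hausdorffMeasure_le_liminf_sum (ι := fun n => A n) b (Z N) _
    (hpow 1 one_pos (6 * (L + 1))) (fun n w => ball (w : W) (3 * (L + 1) * r n))
    (Eventually.of_forall fun n w => hdiam n w)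
    (eventually_atTop.2 ⟨N, fun n hn => by
      simpa only [iUnion_subtype] using (hA n hn).2⟩)
  have hexp : 0 < e + b := by
    have : e = -((Q - s) - p * (1 - s / a)) := by
      rw [he]
      field_simp
      ring
    linarith
  have hsum : ∀ᶠ n in atTop, ∑ w : A n, ediam (ball (w : W) (3 * (L + 1) * r n)) ^ b ≤
      ENNReal.ofReal (B * (6 * (L + 1)) ^ b * r n ^ (e + b)) := by
    refine eventually_atTop.2 ⟨N, fun n hn => ?_⟩
    have h0 := hr0 n
    calc _ ≤ ∑ _w : A n, ENNReal.ofReal (6 * (L + 1) * r n ^ (1 : ℝ)) ^ b :=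
          Finset.sum_le_sum fun w _ => ENNReal.rpow_le_rpow (hdiam n w) hb0
      _ = ENNReal.ofReal (A n).card * ENNReal.ofReal ((6 * (L + 1) * r n) ^ b) := by
          rw [Finset.sum_const, Finset.card_univ, Fintype.card_coe, nsmul_eq_mul, Real.rpow_one,
            ENNReal.ofReal_rpow_of_pos (by positivity), ENNReal.ofReal_natCast]
      _ ≤ ENNReal.ofReal (B * r n ^ e) * ENNReal.ofReal ((6 * (L + 1) * r n) ^ b) := by
          gcongr
          exact (hA n hn).1
      _ = _ := by
          rw [← ENNReal.ofReal_mul (by positivity), Real.mul_rpow (by positivity) h0.le,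
            Real.rpow_add h0 e b]
          congr 1
          ring
  refine le_antisymm (hle.trans ((liminf_le_liminf hsum).trans_eq ?_)) zero_le
  exact (hpow (e + b) hexp _).liminf_eq

end Fibres

end MetricSobolev

/-! ### The dimension bound. -/

open MetricSobolev Filter Topology in
theorem theorem1p4 {X W Y : Type*}
    [MetricSpace X] [ProperSpace X] [MeasurableSpace X] [BorelSpace X]
    [MetricSpace W] [ProperSpace W] [MetricSpace Y]
    (μ : Measure X) [μ.IsOpenPosMeasure] [IsFiniteMeasureOnCompacts μ]
    (Q s p : ℝ) (hQ : 1 ≤ Q) (hs : 0 < s) (hsQ : s < Q) (hp : Q < p)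
    (hhom : MetricSobolev.LocallyHomogeneous μ Q)
    (hpoi : MetricSobolev.LocalPoincare μ Q)
    (π : X → W) (hπ : MetricSobolev.IsLocallyRegular s π)
    (f : X → Y) (hf : Continuous f)
    (hg : ∃ g : X → ℝ≥0∞, MetricSobolev.IsUpperGradient f g ∧ MetricSobolev.MemLpLoc μ p g)
    (α : ℝ) (hα : α ∈ Ioc s (p * s / (p - Q + s))) :
    dimH {a : W | ENNReal.ofReal α ≤ dimH (f '' (π ⁻¹' {a}))} ≤
      ENNReal.ofReal ((Q - s) - p * (1 - s / α)) := by
  obtain ⟨g, hg, hgp⟩ := hg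
  obtain ⟨hsα, hαp⟩ := hα
  have hα0 : 0 < α := hs.trans hsα
  have hQ0 : 0 < Q := one_pos.trans_le hQ
  -- Hölder needs exponents at most `p`; the upper limit for `α` is below `p` since `s < p - Q + s`.
  have hαp' : α < p := hαp.trans_lt <| by
    rw [div_lt_iff₀ (by linarith)]
    exact mul_lt_mul_of_pos_left (by linarith) (by linarith)
  borelize W Y
  refine le_of_forall_gt_imp_ge_of_dense fun c hc => ?_
  rcases eq_or_ne c ∞ with rfl | hct
  · exact le_top
  lift c to NNReal using hct
  have hc' : (Q - s) - p * (1 - s / α) < c :=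
    lt_of_not_ge fun h => hc.not_ge (by simpa using ENNReal.ofReal_le_ofReal h)
  have hcont : ContinuousAt (fun x : ℝ => (Q - s) - p * (1 - s / x)) α := by
    fun_prop (disch := exact hα0.ne')
  -- Dimension at least `α` yields infinite measure only in dimensions `a < α`; continuity of the
  -- bound in `a` keeps it below `c`.
  have hev : ∀ᶠ x in 𝓝[<] α, (Q - s) - p * (1 - s / x) < c ∧ 0 < x ∧ x < α := by
    filter_upwards [(hcont.eventually (gt_mem_nhds hc')).filter_mono nhdsWithin_le_nhds,
      (lt_mem_nhds hα0).filter_mono nhdsWithin_le_nhds, self_mem_nhdsWithin] with x h1 h2 h3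
    exact ⟨h1, h2, h3⟩
  obtain ⟨a, hab, ha0, haα⟩ := hev.exists
  have hnull : Measure.hausdorffMeasure (c : ℝ)
      {w : W | ENNReal.ofReal α ≤ dimH (f '' (π ⁻¹' {w}))} = 0 := by
    refine measure_mono_null (t := ⋃ n, {w | Measure.hausdorffMeasure a
      (f '' (compactCovering X n ∩ π ⁻¹' {w})) = ∞}) (fun w hw => ?_)
      (measure_iUnion_null fun n => hausdorffMeasure_setOf_eq_top_eq_zero hhom hpoi hQ0 hp hπ hf
        hg hgp (isCompact_compactCovering X n) ha0 (haα.le.trans hαp'.le) c.2 hab)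
    have hU : f '' (π ⁻¹' {w}) = ⋃ n, f '' (compactCovering X n ∩ π ⁻¹' {w}) := by
      rw [← image_iUnion, ← iUnion_inter, iUnion_compactCovering, univ_inter]
    -- The dimension of a countable union is the supremum of the dimensions, so a single compact
    -- piece already exceeds `a`.
    have hlt : ENNReal.ofReal a < dimH (f '' (π ⁻¹' {w})) :=
      ((ENNReal.ofReal_lt_ofReal_iff hα0).2 haα).trans_le hw
    rw [hU, dimH_iUnion, lt_iSup_iff] at hlt
    obtain ⟨n, hn⟩ := hlt
    have := hausdorffMeasure_of_lt_dimH (d := a.toNNReal) hn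
    rw [Real.coe_toNNReal a ha0.le] at this
    exact mem_iUnion.2 ⟨n, this⟩
  exact dimH_le_of_hausdorffMeasure_ne_top (hnull ▸ ENNReal.zero_ne_top)
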